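/- Let $Y=[0,1]^d$ and let $\mathcal L:Y\to\mathbb R$. Define the derivative-based Hardy–Krause variation recursively by $$\hat V_{HK}(f)=\int_Y\Big|\frac{\partial^d f(y)}{\partial y_1\cdots\partial y_d}\Big|\,dy+\sum_{i=1}^d\hat V_{HK}\big(f|_{\{y_i=1\}}\big)\in[0,\infty],$$ where $f|_{\{y_i=1\}}$ is regarded as a function on $[0,1]^{d-1}$ and $\hat V_{HK}=0$ in dimension $0$. Here the integral is finite only for $f$ continuous on the closed cube whose mixed derivative $\partial^d f/\partial y_1\cdots\partial y_d$ on the open cube (in the sense of distributions) is an integrable function; otherwise it is $\infty$. Assume that $\hat V_{HK}(\mathcal L)<\infty$. Let $\sigma\in C^d(\mathbb R)$, fix a number of layers and the layer widths $d_1=d,d_2,\dots,d_K,d_{K+1}=1$, and for parameters $\theta=\{W_k,b_k\}_{1\le k\le K}$ let $\mathcal L_\theta=C_K\circ\sigma\circ C_{K-1}\circ\cdots\circ\sigma\circ C_1$ with $C_kz=W_kz+b_k$, $W_k\in\mathbb R^{d_{k+1}\times d_k}$, $b_k\in\mathbb R^{d_{k+1}}$, and $\sigma$ applied componentwise. For points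 $y_1,\dots,y_N\in Y$ let $$\mathcal E_G(\theta)=\int_Y|\mathcal L(y)-\mathcal L_\theta(y)|\,dy,\qquad \mathcal E_T(\theta)=\frac1N\sum_{n=1}^N|\mathcal L(y_n)-\mathcal L_\theta(y_n)|,$$ $$D_N^*=\sup_{z\in Y}\Big|\frac1N\#\{n:\ y_n\in\textstyle\prod_i[0,z_i)\}-\prod_iz_i\Big|.$$ Let $\delta>0$, $R>0$ and $A>0$. Then there is a constant $C$, depending on $d$, $\delta$, $\mathcal L$, $\sigma$, the network architecture, $R$ and $A$, but independent of $N$, of the points $y_n$ and of $\theta$, such that for every $N\ge1$, every choice of points $y_1,\dots,y_N\in Y$ of low discrepancy, $D^*_N\le A(\log N)^d/N$, and every $\theta$ all of whose weights and biases are at most $R$ in absolute value (in particular for the parameters $\theta^*$ produced by training on $\{y_n\}$, as long as they satisfy this bound), $$\mathcal E_G(\theta)\le\mathcal E_T(\theta)+\frac{C(\log N)^d}{N}+2\delta .$$ -/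

import Mathlib

open MeasureTheory
open scoped ENNReal ContDiff

/-- The closed unit cube `Y = [0,1]^d`. -/
def unitCube (d : ℕ) : Set (Fin d → ℝ) := Set.Icc 0 1

/-- Smooth test functions with compact support in the open unit cube `(0,1)^d`. -/
structure IsTestFunction {d : ℕ} (φ : (Fin d → ℝ) → ℝ) : Prop where
  smooth : ContDiff ℝ ∞ φ
  compact : HasCompactSupport φ
  support : tsupport φ ⊆ Set.pi Set.univ (fun _ => Set.Ioo (0 : ℝ) 1)

/-- The full mixed partial derivative `∂^d φ / ∂y_1 ⋯ ∂y_d` of a smooth function. -/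
noncomputable def mixedPartial {d : ℕ} (φ : (Fin d → ℝ) → ℝ) (y : Fin d → ℝ) : ℝ :=
  iteratedFDeriv ℝ d φ y (fun i => Pi.single i (1 : ℝ))

/-- `f` is continuous on the closed cube and `g ∈ L¹` is its mixed partial derivative
`∂^d f / ∂y_1 ⋯ ∂y_d` in the open cube, in the sense of distributions (for a function with a
continuous, or just everywhere defined and integrable, classical mixed derivative this is that
derivative). -/
structure HasMixedDeriv {d : ℕ} (f g : (Fin d → ℝ) → ℝ) : Prop where
  continuousOn : ContinuousOn f (unitCube d)
  integrableOn : IntegrableOn g (unitCube d)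
  weak : ∀ φ : (Fin d → ℝ) → ℝ, IsTestFunction φ →
    ∫ y in unitCube d, f y * mixedPartial φ y = (-1) ^ d * ∫ y in unitCube d, g y * φ y

/-- `∫_Y |∂^d f / ∂y_1 ⋯ ∂y_d| dy`. The mixed derivative is unique almost everywhere, so the infimum
is over at most one value; it is `∞` when `f` has no integrable mixed derivative. -/
noncomputable def mixedDerivL1 {d : ℕ} (f : (Fin d → ℝ) → ℝ) : ℝ≥0∞ :=
  ⨅ (g : (Fin d → ℝ) → ℝ) (_ : HasMixedDeriv f g), ∫⁻ y in unitCube d, ‖g y‖ₑ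

/-- The derivative-based Hardy–Krause variation of `f` on `[0,1]^d`, by recursion on the dimension:
`∫_Y |∂^d f / ∂y_1 ⋯ ∂y_d| dy + ∑ i, V (f restricted to the face y_i = 1)`. -/
noncomputable def hatVHK : (d : ℕ) → ((Fin d → ℝ) → ℝ) → ℝ≥0∞
  | 0, _ => 0
  | d + 1, f => mixedDerivL1 f +
      ∑ i : Fin (d + 1), hatVHK d (fun x : Fin d → ℝ => f (i.insertNth (1 : ℝ) x))

/-- `R_N(J) = (1/N) #{n : y_n ∈ J} - meas(J)`. -/
noncomputable def quadratureDefect {d N : ℕ} (y : Fin N → Fin d → ℝ) (J : Set (Fin d → ℝ)) : ℝ :=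
  (1 / (N : ℝ)) * ({n : Fin N | y n ∈ J}.ncard : ℝ) - volume.real J

/-- The star discrepancy: the supremum of `|R_N(J)|` over the boxes `J = ∏ i, [0, z_i)`,
`z ∈ [0,1]^d`. -/
noncomputable def starDiscrepancy {d N : ℕ} (y : Fin N → Fin d → ℝ) : ℝ :=
  ⨆ z : unitCube d,
    |quadratureDefect y (Set.pi Set.univ (fun i => Set.Ico (0 : ℝ) ((z : Fin d → ℝ) i)))|

/-- The points `y_1, …, y_N` lie in `[0,1]^d` and are of low discrepancy with constant `A`. -/
structure IsLowDiscrepancy {d N : ℕ} (A : ℝ) (y : Fin N → Fin d → ℝ) : Prop where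
  mem : ∀ n, y n ∈ unitCube d
  bound : starDiscrepancy y ≤ A * Real.log (N : ℝ) ^ d / (N : ℝ)

/-- The weights and biases of a fully connected feedforward network with input dimension `m`, scalar
output, and hidden layers of the listed widths: one affine map `z ↦ W z + b` per layer. -/
inductive NetParams : ℕ → List ℕ → Type
  | output {m : ℕ} (W : Matrix (Fin 1) (Fin m) ℝ) (b : Fin 1 → ℝ) : NetParams m []
  | hidden {m n : ℕ} {ws : List ℕ} (W : Matrix (Fin n) (Fin m) ℝ) (b : Fin n → ℝ)
      (rest : NetParams n ws) : NetParams m (n :: ws)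

/-- The function `C_K ∘ σ ∘ C_{K-1} ∘ ⋯ ∘ σ ∘ C_1` of the network, with `σ` acting componentwise. -/
noncomputable def NetParams.realize (σ : ℝ → ℝ) :
    {m : ℕ} → {ws : List ℕ} → NetParams m ws → (Fin m → ℝ) → ℝ
  | _, _, .output W b, z => (W.mulVec z + b) 0
  | _, _, .hidden W b rest, z => rest.realize σ (fun i => σ ((W.mulVec z + b) i))

/-- All weights and biases are at most `R` in absolute value. -/
def NetParams.BoundedBy (R : ℝ) : {m : ℕ} → {ws : List ℕ} → NetParams m ws → Prop
  | _, _, .output W b => (∀ i j, |W i j| ≤ R) ∧ ∀ i, |b i| ≤ R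
  | _, _, .hidden W b rest => (∀ i j, |W i j| ≤ R) ∧ (∀ i, |b i| ≤ R) ∧ rest.BoundedBy R

/-- The generalization error `∫_Y |L(y) - L*(y)| dy`. -/
noncomputable def generalizationError {d : ℕ} (L Lstar : (Fin d → ℝ) → ℝ) : ℝ :=
  ∫ y in unitCube d, |L y - Lstar y|

/-- The training error `(1/N) ∑ n, |L(y_n) - L*(y_n)|`. -/
noncomputable def trainingError {d N : ℕ} (L Lstar : (Fin d → ℝ) → ℝ) (y : Fin N → Fin d → ℝ) : ℝ :=
  (1 / (N : ℝ)) * ∑ n, |L (y n) - Lstar (y n)|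

/-!
The constant may depend on `δ`, so it is enough to control the quadrature error of a family of
functions that is uniformly bounded and uniformly equicontinuous on the cube.

The family in question is `|L - L_θ|`, with `θ` bounded by `R`. Finiteness of the Hardy–Krause
variation makes `L` continuous on the closed cube, hence bounded and uniformly continuous there. For
the networks, boundedness and equicontinuity pass through the layers one at a time, since the affine
maps are uniformly Lipschitz and `σ` is uniformly continuous on compact intervals
(`NetParams.exists_bound_and_equicontinuous`).

Cut the cube into `m ^ d` half-open cells on which every function of the family oscillates by at most
`δ`. By inclusion–exclusion over the lower corners, a box inside the cube has quadrature defect at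
most `2 ^ d` times the star discrepancy (`abs_quadratureDefect_box_le`). Replacing a nonnegative
function by its values at the cell corners costs `δ` in the integral and `δ` in the average, and the
corner values, weighted by the cell defects, cost at most `m ^ d * M * 2 ^ d` times the star
discrepancy (`setIntegral_le_average_add`). Sample points on the upper faces of the cube belong to no
cell, but they can only increase the average.
-/

/-! ### Quadrature defect of boxes -/

/-- The half-open box `∏ i, [a i, b i)`. -/
def halfOpenBox {d : ℕ} (a b : Fin d → ℝ) : Set (Fin d → ℝ) :=
  Set.pi Set.univ fun i => Set.Ico (a i) (b i)

lemma mem_halfOpenBox {d : ℕ} {a b x : Fin d → ℝ} :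
    x ∈ halfOpenBox a b ↔ ∀ i, a i ≤ x i ∧ x i < b i := by
  simp [halfOpenBox]

lemma measurableSet_halfOpenBox {d : ℕ} (a b : Fin d → ℝ) : MeasurableSet (halfOpenBox a b) :=
  MeasurableSet.univ_pi fun _ => measurableSet_Ico

lemma volume_halfOpenBox_ne_top {d : ℕ} (a b : Fin d → ℝ) : volume (halfOpenBox a b) ≠ ⊤ := by
  rw [halfOpenBox, Real.volume_pi_Ico]
  exact ENNReal.prod_ne_top fun _ _ => ENNReal.ofReal_ne_top

lemma volumeReal_halfOpenBox {d : ℕ} {a b : Fin d → ℝ} (h : a ≤ b) :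
    volume.real (halfOpenBox a b) = ∏ i, (b i - a i) := by
  rw [measureReal_def, halfOpenBox, Real.volume_pi_Ico_toReal h]

lemma quadratureDefect_union {d N : ℕ} (y : Fin N → Fin d → ℝ) {J K : Set (Fin d → ℝ)}
    (hJK : Disjoint J K) (hK : MeasurableSet K) (hJ' : volume J ≠ ⊤) (hK' : volume K ≠ ⊤) :
    quadratureDefect y (J ∪ K) = quadratureDefect y J + quadratureDefect y K := by
  have hcount : {n : Fin N | y n ∈ J ∪ K}.ncard =
      {n : Fin N | y n ∈ J}.ncard + {n : Fin N | y n ∈ K}.ncard := by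
    exact Set.ncard_union_eq (hJK.preimage y) (Set.toFinite _) (Set.toFinite _)
  rw [quadratureDefect, quadratureDefect, quadratureDefect, hcount,
    measureReal_union hJK hK hJ' hK']
  push_cast
  ring

lemma abs_quadratureDefect_anchored_le {d N : ℕ} (y : Fin N → Fin d → ℝ) {z : Fin d → ℝ}
    (hz : z ∈ unitCube d) : |quadratureDefect y (halfOpenBox 0 z)| ≤ starDiscrepancy y := by
  -- The supremum is over a bounded set, so it is not a junk value.
  have hbdd : BddAbove (Set.range fun z : unitCube d => |quadratureDefect y
      (Set.pi Set.univ fun i => Set.Ico (0 : ℝ) ((z : Fin d → ℝ) i))|) := by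
    refine ⟨|1 / (N : ℝ)| * N + 1, ?_⟩
    rintro _ ⟨⟨w, hw0, hw1⟩, rfl⟩
    refine (abs_sub _ _).trans (add_le_add ?_ ?_)
    · rw [abs_mul, Nat.abs_cast]
      refine mul_le_mul_of_nonneg_left ?_ (abs_nonneg _)
      have := Set.ncard_le_card {n : Fin N | y n ∈ halfOpenBox 0 w}
      rw [Nat.card_fin] at this
      exact_mod_cast this
    · have := volumeReal_halfOpenBox hw0
      rw [halfOpenBox] at this
      simp only [Pi.zero_apply, sub_zero] at this
      change |volume.real (Set.pi Set.univ fun i => Set.Ico (0 : ℝ) (w i))| ≤ 1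
      rw [abs_of_nonneg measureReal_nonneg, this]
      exact Finset.prod_le_one (fun i _ => hw0 i) fun i _ => hw1 i
  exact le_ciSup hbdd ⟨z, hz⟩

lemma starDiscrepancy_nonneg {d N : ℕ} (y : Fin N → Fin d → ℝ) : 0 ≤ starDiscrepancy y :=
  Real.iSup_nonneg fun _ => abs_nonneg _

/-- Only the lower corner coordinates in `s` may differ from `0`; each of them doubles the number
of anchored boxes of which the indicator of the box is a signed sum. -/
lemma abs_quadratureDefect_box_le_of_support {d N : ℕ} (y : Fin N → Fin d → ℝ)
    (s : Finset (Fin d)) : ∀ a b : Fin d → ℝ, 0 ≤ a → a ≤ b → b ≤ 1 → (∀ i ∉ s, a i = 0) →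
      |quadratureDefect y (halfOpenBox a b)| ≤ 2 ^ s.card * starDiscrepancy y := by
  induction s using Finset.induction_on with
  | empty =>
    intro a b ha hab hb h0
    obtain rfl : a = 0 := funext fun i => h0 i (Finset.notMem_empty i)
    simpa using abs_quadratureDefect_anchored_le y ⟨hab, hb⟩
  | insert i s hi ih =>
    intro a b ha hab hb h0
    have ha' : 0 ≤ Function.update a i 0 := by
      intro k
      by_cases hk : k = i
      · subst hk; simp
      · simpa [hk] using ha k
    have hs' : ∀ k ∉ s, Function.update a i 0 k = 0 := by
      intro k hk
      by_cases hki : k = i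
      · subst hki; simp
      · simpa [hki] using h0 k (by simp [hki, hk])
    have hbig := ih (Function.update a i 0) b ha' (by
      intro k
      by_cases hk : k = i
      · subst hk; simpa using (ha k).trans (hab k)
      · simpa [hk] using hab k) hb hs'
    have hlow := ih (Function.update a i 0) (Function.update b i (a i)) ha' (by
      intro k
      by_cases hk : k = i
      · subst hk; simpa using ha k
      · simpa [hk] using hab k) (by
      intro k
      by_cases hk : k = i
      · subst hk; simpa using (hab k).trans (hb k)
      · simpa [hk] using hb k) hs'
    have hunion : halfOpenBox (Function.update a i 0) b =
        halfOpenBox (Function.update a i 0) (Function.update b i (a i)) ∪ halfOpenBox a b := by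
      ext x
      simp only [Set.mem_union, mem_halfOpenBox]
      constructor
      · intro h
        by_cases hx : x i < a i
        · left
          intro k
          by_cases hk : k = i
          · subst hk; simpa [hx] using (h k).1
          · simpa [hk] using h k
        · right
          intro k
          by_cases hk : k = i
          · subst hk; exact ⟨not_lt.mp hx, (h k).2⟩
          · simpa [hk] using h k
      · rintro (h | h) k
        · by_cases hk : k = i
          · subst hk
            have := h k
            simp only [Function.update_self] at this ⊢
            exact ⟨this.1, this.2.trans_le (hab k)⟩
          · simpa [hk] using h k
        · by_cases hk : k = i
          · subst hk; simpa using ⟨(ha k).trans (h k).1, (h k).2⟩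
          · simpa [hk] using h k
    have hdisj : Disjoint (halfOpenBox (Function.update a i 0) (Function.update b i (a i)))
        (halfOpenBox a b) := by
      rw [Set.disjoint_left]
      intro x hx hx'
      have h1 := (mem_halfOpenBox.mp hx i).2
      rw [Function.update_self] at h1
      exact absurd (mem_halfOpenBox.mp hx' i).1 (not_le.mpr h1)
    have hsum := quadratureDefect_union y hdisj (measurableSet_halfOpenBox _ _)
      (volume_halfOpenBox_ne_top _ _) (volume_halfOpenBox_ne_top _ _)
    rw [← hunion] at hsum
    rw [Finset.card_insert_of_notMem hi, pow_succ]
    rw [abs_le] at hbig hlow ⊢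
    constructor <;> linarith [hbig.1, hbig.2, hlow.1, hlow.2]

lemma abs_quadratureDefect_box_le {d N : ℕ} (y : Fin N → Fin d → ℝ) {a b : Fin d → ℝ}
    (ha : 0 ≤ a) (hab : a ≤ b) (hb : b ≤ 1) :
    |quadratureDefect y (halfOpenBox a b)| ≤ 2 ^ d * starDiscrepancy y := by
  simpa using abs_quadratureDefect_box_le_of_support y Finset.univ a b ha hab hb (by simp)

/-! ### The uniform grid -/

/-- The lower corner `j / m` of the grid cell with index `j`. -/
noncomputable def gridCorner {d m : ℕ} (j : Fin d → Fin m) : Fin d → ℝ :=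
  fun i => ((j i : ℕ) : ℝ) / m

/-- The half-open grid cell `∏ i, [j i / m, (j i + 1) / m)`. -/
noncomputable def gridCell {d m : ℕ} (j : Fin d → Fin m) : Set (Fin d → ℝ) :=
  halfOpenBox (gridCorner j) fun i => (((j i : ℕ) : ℝ) + 1) / m

section Grid

variable {d m : ℕ}

lemma gridCorner_nonneg (j : Fin d → Fin m) : 0 ≤ gridCorner j := fun i => by
  simp only [gridCorner, Pi.zero_apply]; positivity

lemma gridCorner_le (j : Fin d → Fin m) : gridCorner j ≤ fun i => (((j i : ℕ) : ℝ) + 1) / m :=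
  fun i => by simp only [gridCorner]; gcongr; linarith

lemma grid_upper_le_one (j : Fin d → Fin m) :
    (fun i => (((j i : ℕ) : ℝ) + 1) / m) ≤ (1 : Fin d → ℝ) := fun i => by
  refine div_le_one_of_le₀ ?_ (Nat.cast_nonneg m)
  exact_mod_cast (j i).isLt

lemma gridCorner_mem (j : Fin d → Fin m) : gridCorner j ∈ unitCube d :=
  ⟨gridCorner_nonneg j, (gridCorner_le j).trans (grid_upper_le_one j)⟩

lemma gridCell_subset (j : Fin d → Fin m) : gridCell j ⊆ unitCube d := fun _ hx =>
  ⟨fun i => (gridCorner_nonneg j i).trans (mem_halfOpenBox.mp hx i).1,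
    fun i => (mem_halfOpenBox.mp hx i).2.le.trans (grid_upper_le_one j i)⟩

lemma dist_gridCorner_le {j : Fin d → Fin m} {x : Fin d → ℝ} (hx : x ∈ gridCell j) :
    dist x (gridCorner j) ≤ 1 / m := by
  refine (dist_pi_le_iff (by positivity)).mpr fun i => ?_
  have h := mem_halfOpenBox.mp hx i
  rw [add_div] at h
  have h2 : gridCorner j i = ((j i : ℕ) : ℝ) / m := rfl
  rw [Real.dist_eq, abs_le]
  constructor <;> linarith [h.1, h.2, (by positivity : (0 : ℝ) ≤ 1 / m)]

lemma volumeReal_gridCell (j : Fin d → Fin m) : volume.real (gridCell j) = (1 / (m : ℝ)) ^ d := by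
  rw [gridCell, volumeReal_halfOpenBox (gridCorner_le j)]
  have : ∀ i, (((j i : ℕ) : ℝ) + 1) / m - gridCorner j i = 1 / m := fun i => by
    rw [gridCorner]; ring
  simp [this]

lemma floor_of_mem_gridCell (hm : 0 < m) {j : Fin d → Fin m} {x : Fin d → ℝ}
    (hx : x ∈ gridCell j) (i : Fin d) : ⌊x i * m⌋₊ = (j i : ℕ) := by
  have hm' : (0 : ℝ) < m := Nat.cast_pos.mpr hm
  obtain ⟨h1, h2⟩ := mem_halfOpenBox.mp hx i
  rw [gridCorner, div_le_iff₀ hm'] at h1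
  rw [lt_div_iff₀ hm'] at h2
  exact (Nat.floor_eq_iff ((Nat.cast_nonneg _).trans h1)).mpr ⟨h1, h2⟩

lemma gridCell_index_unique (hm : 0 < m) {j k : Fin d → Fin m} {x : Fin d → ℝ}
    (hj : x ∈ gridCell j) (hk : x ∈ gridCell k) : j = k :=
  funext fun i => Fin.ext <|
    (floor_of_mem_gridCell hm hj i).symm.trans (floor_of_mem_gridCell hm hk i)

lemma pairwise_disjoint_gridCell (hm : 0 < m) :
    Pairwise (Function.onFun Disjoint (gridCell : (Fin d → Fin m) → Set (Fin d → ℝ))) :=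
  fun _ _ hjk => Set.disjoint_left.mpr fun _ hj hk => hjk (gridCell_index_unique hm hj hk)

lemma iUnion_gridCell (hm : 0 < m) :
    ⋃ j : Fin d → Fin m, gridCell j = halfOpenBox (0 : Fin d → ℝ) 1 := by
  have hm' : (0 : ℝ) < m := Nat.cast_pos.mpr hm
  ext x
  rw [Set.mem_iUnion]
  constructor
  · rintro ⟨j, hj⟩
    exact mem_halfOpenBox.mpr fun i => ⟨(gridCorner_nonneg j i).trans (mem_halfOpenBox.mp hj i).1,
      (mem_halfOpenBox.mp hj i).2.trans_le (grid_upper_le_one j i)⟩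
  · intro hx
    rw [mem_halfOpenBox] at hx
    have hx0 : ∀ i, 0 ≤ x i * m := fun i => mul_nonneg (hx i).1 hm'.le
    have hlt : ∀ i, ⌊x i * m⌋₊ < m := fun i => (Nat.floor_lt (hx0 i)).mpr <| by
      simpa using mul_lt_mul_of_pos_right (hx i).2 hm'
    refine ⟨fun i => ⟨⌊x i * m⌋₊, hlt i⟩, mem_halfOpenBox.mpr fun i => ⟨?_, ?_⟩⟩
    · exact (div_le_iff₀ hm').mpr (Nat.floor_le (hx0 i))
    · exact (lt_div_iff₀ hm').mpr (Nat.lt_floor_add_one _)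

lemma setIntegral_unitCube_eq_sum (hm : 0 < m) {f : (Fin d → ℝ) → ℝ}
    (hf : IntegrableOn f (unitCube d)) :
    ∫ x in unitCube d, f x = ∑ j : Fin d → Fin m, ∫ x in gridCell j, f x := by
  have hae : (halfOpenBox (0 : Fin d → ℝ) 1 : Set (Fin d → ℝ)) =ᵐ[volume] unitCube d :=
    Measure.univ_pi_Ico_ae_eq_Icc (μ := fun _ : Fin d => (volume : Measure ℝ))
  rw [← setIntegral_congr_set hae, ← iUnion_gridCell hm]
  exact integral_iUnion_fintype (fun j => measurableSet_halfOpenBox _ _)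
    (pairwise_disjoint_gridCell hm) fun j => hf.mono_set (gridCell_subset j)

end Grid

/-! ### Quadrature of functions with controlled oscillation -/

/-- One-sided quadrature estimate for a nonnegative function that oscillates by at most `δ` at
distances up to the mesh `1 / m`. -/
lemma setIntegral_le_average_add {d m N : ℕ} (hm : 0 < m) (hN : 0 < N) {f : (Fin d → ℝ) → ℝ}
    {M δ : ℝ} (hf : ContinuousOn f (unitCube d)) (hf0 : ∀ x, 0 ≤ f x) (hδ : 0 ≤ δ)
    (hM : ∀ x ∈ unitCube d, f x ≤ M)
    (hosc : ∀ x ∈ unitCube d, ∀ x' ∈ unitCube d, dist x x' ≤ 1 / m → |f x - f x'| ≤ δ)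
    {y : Fin N → Fin d → ℝ} (hy : ∀ n, y n ∈ unitCube d) :
    ∫ x in unitCube d, f x ≤
      1 / (N : ℝ) * ∑ n, f (y n) + (m : ℝ) ^ d * (M * (2 ^ d * starDiscrepancy y)) + 2 * δ := by
  classical
  have hint : IntegrableOn f (unitCube d) := hf.integrableOn_compact isCompact_Icc
  have hm' : (m : ℝ) ≠ 0 := Nat.cast_ne_zero.mpr hm.ne'
  have hcell : ∀ j : Fin d → Fin m,
      ∫ x in gridCell j, f x ≤ f (gridCorner j) * volume.real (gridCell j) +
        δ * (1 / (m : ℝ)) ^ d := by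
    intro j
    calc ∫ x in gridCell j, f x ≤ ∫ _ in gridCell j, (f (gridCorner j) + δ) := by
          refine setIntegral_mono_on (hint.mono_set (gridCell_subset j))
            (integrableOn_const (volume_halfOpenBox_ne_top _ _)) (measurableSet_halfOpenBox _ _) ?_
          intro x hx
          linarith [(abs_le.mp (hosc x (gridCell_subset j hx) _ (gridCorner_mem j)
            (dist_gridCorner_le hx))).2]
      _ = _ := by rw [setIntegral_const, smul_eq_mul, volumeReal_gridCell]; ring
  have hintegral : ∫ x in unitCube d, f x ≤
      ∑ j : Fin d → Fin m, f (gridCorner j) * volume.real (gridCell j) + δ := by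
    rw [setIntegral_unitCube_eq_sum hm hint]
    refine (Finset.sum_le_sum fun j _ => hcell j).trans (le_of_eq ?_)
    rw [Finset.sum_add_distrib, Finset.sum_const, Finset.card_univ]
    simp only [Fintype.card_pi, Fintype.card_fin, Finset.prod_const, Finset.card_univ,
      nsmul_eq_mul, Nat.cast_pow, one_div, inv_pow]
    field_simp
  have hpoint : ∀ n, ∑ j : Fin d → Fin m, (if y n ∈ gridCell j then f (gridCorner j) else 0) ≤
      f (y n) + δ := by
    intro n
    by_cases h : ∃ j : Fin d → Fin m, y n ∈ gridCell j
    · obtain ⟨k, hk⟩ := h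
      rw [Finset.sum_eq_single_of_mem k (Finset.mem_univ k) fun j _ hjk =>
        if_neg fun hj => hjk (gridCell_index_unique hm hj hk), if_pos hk]
      linarith [(abs_le.mp (hosc _ (hy n) _ (gridCorner_mem k) (dist_gridCorner_le hk))).1]
    · push Not at h
      simpa [h] using add_nonneg (hf0 (y n)) hδ
  have haverage : ∑ j : Fin d → Fin m,
      f (gridCorner j) * (1 / (N : ℝ) * ({n : Fin N | y n ∈ gridCell j}.ncard : ℝ)) ≤
      1 / (N : ℝ) * ∑ n, f (y n) + δ := by
    have hswap : ∑ j : Fin d → Fin m,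
        f (gridCorner j) * (1 / (N : ℝ) * ({n : Fin N | y n ∈ gridCell j}.ncard : ℝ)) =
        1 / (N : ℝ) * ∑ n, ∑ j : Fin d → Fin m,
          (if y n ∈ gridCell j then f (gridCorner j) else 0) := by
      rw [Finset.sum_comm, Finset.mul_sum]
      refine Finset.sum_congr rfl fun j _ => ?_
      rw [← Finset.sum_filter, Finset.sum_const, nsmul_eq_mul, Set.ncard_eq_toFinset_card',
        Set.toFinset_ofPred]
      ring
    rw [hswap]
    refine (mul_le_mul_of_nonneg_left (Finset.sum_le_sum fun n _ => hpoint n)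
      (by positivity)).trans (le_of_eq ?_)
    rw [Finset.sum_add_distrib, Finset.sum_const, Finset.card_univ, Fintype.card_fin,
      nsmul_eq_mul]
    field_simp
  have hdefect : ∑ j : Fin d → Fin m, f (gridCorner j) * volume.real (gridCell j) -
      ∑ j : Fin d → Fin m,
        f (gridCorner j) * (1 / (N : ℝ) * ({n : Fin N | y n ∈ gridCell j}.ncard : ℝ)) ≤
      (m : ℝ) ^ d * (M * (2 ^ d * starDiscrepancy y)) := by
    rw [← Finset.sum_sub_distrib]
    have hterm : ∀ j ∈ (Finset.univ : Finset (Fin d → Fin m)),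
        f (gridCorner j) * volume.real (gridCell j) -
          f (gridCorner j) * (1 / (N : ℝ) * ({n : Fin N | y n ∈ gridCell j}.ncard : ℝ)) ≤
        M * (2 ^ d * starDiscrepancy y) := by
      intro j _
      have hbox : |quadratureDefect y (gridCell j)| ≤ 2 ^ d * starDiscrepancy y :=
        abs_quadratureDefect_box_le y (gridCorner_nonneg j) (gridCorner_le j) (grid_upper_le_one j)
      calc _ = f (gridCorner j) * -quadratureDefect y (gridCell j) := by
            rw [quadratureDefect]; ring
        _ ≤ f (gridCorner j) * (2 ^ d * starDiscrepancy y) :=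
            mul_le_mul_of_nonneg_left (by linarith [(abs_le.mp hbox).1]) (hf0 _)
        _ ≤ _ := mul_le_mul_of_nonneg_right (hM _ (gridCorner_mem j))
            (mul_nonneg (by positivity) (starDiscrepancy_nonneg y))
    refine (Finset.sum_le_card_nsmul _ _ _ hterm).trans (le_of_eq ?_)
    simp [nsmul_eq_mul]
  linarith

/-! ### Networks with bounded parameters -/

lemma abs_mulVec_le {m n : ℕ} {R B : ℝ} (hR : 0 ≤ R) {W : Matrix (Fin n) (Fin m) ℝ}
    (hW : ∀ i j, |W i j| ≤ R) {z : Fin m → ℝ} (hz : ∀ j, |z j| ≤ B) (i : Fin n) :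
    |W.mulVec z i| ≤ m * (R * B) := by
  change |∑ j, W i j * z j| ≤ _
  refine (Finset.abs_sum_le_sum_abs _ _).trans ?_
  refine (Finset.sum_le_card_nsmul _ _ (R * B) fun j _ => ?_).trans (by simp [nsmul_eq_mul])
  rw [abs_mul]
  exact mul_le_mul (hW i j) (hz j) (abs_nonneg _) hR

lemma NetParams.exists_bound_and_equicontinuous {σ : ℝ → ℝ} (hσ : Continuous σ) {R : ℝ}
    (hR : 0 ≤ R) (ws : List ℕ) : ∀ (m : ℕ) (B : ℝ), 0 ≤ B →
    (∃ M : ℝ, ∀ θ : NetParams m ws, θ.BoundedBy R → ∀ z : Fin m → ℝ, (∀ i, |z i| ≤ B) →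
      |θ.realize σ z| ≤ M) ∧
    ∀ ε > 0, ∃ η > 0, ∀ θ : NetParams m ws, θ.BoundedBy R → ∀ z z' : Fin m → ℝ,
      (∀ i, |z i| ≤ B) → (∀ i, |z' i| ≤ B) → (∀ i, |z i - z' i| ≤ η) →
      |θ.realize σ z - θ.realize σ z'| ≤ ε := by
  have haff : ∀ {m n : ℕ} {W : Matrix (Fin n) (Fin m) ℝ} {b : Fin n → ℝ} {B : ℝ},
      (∀ i j, |W i j| ≤ R) → (∀ i, |b i| ≤ R) → ∀ z : Fin m → ℝ, (∀ i, |z i| ≤ B) →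
      ∀ i, |(W.mulVec z + b) i| ≤ m * (R * B) + R := fun hW hb z hz i =>
    (abs_add_le _ _).trans (add_le_add (abs_mulVec_le hR hW hz i) (hb i))
  have hdiff : ∀ {m n : ℕ} {W : Matrix (Fin n) (Fin m) ℝ} {b : Fin n → ℝ} {η ε : ℝ},
      (∀ i j, |W i j| ≤ R) → η ≤ ε / (m * R + 1) → ∀ z z' : Fin m → ℝ, (∀ i, |z i - z' i| ≤ η) →
      0 ≤ ε → ∀ i, |(W.mulVec z + b) i - (W.mulVec z' + b) i| ≤ ε := by
    intro m n W b η ε hW hη z z' hz hε i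
    have hpos : 0 < m * R + 1 := by positivity
    have heq : (W.mulVec z + b) i - (W.mulVec z' + b) i = W.mulVec (z - z') i := by
      rw [Matrix.mulVec_sub]; simp
    rw [heq]
    refine (abs_mulVec_le (B := ε / (m * R + 1)) hR hW (fun j => (hz j).trans hη) i).trans ?_
    rw [← mul_assoc, mul_div_assoc', div_le_iff₀ hpos]
    nlinarith
  induction ws with
  | nil =>
    intro m B hB
    refine ⟨⟨m * (R * B) + R, ?_⟩, fun ε hε => ⟨ε / (m * R + 1), by positivity, ?_⟩⟩
    · rintro (⟨W, b⟩) ⟨hW, hb⟩ z hz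
      exact haff hW hb z hz 0
    · rintro (⟨W, b⟩) ⟨hW, hb⟩ z z' - - hzz'
      exact hdiff hW le_rfl z z' hzz' hε.le 0
  | cons n ws ih =>
    intro m B hB
    set B₁ : ℝ := m * (R * B) + R with hB₁
    obtain ⟨B₂, hB₂⟩ := (isCompact_Icc (a := -B₁) (b := B₁)).exists_bound_of_continuousOn
      hσ.continuousOn
    have hσB : ∀ t : ℝ, |t| ≤ B₁ → |σ t| ≤ max B₂ 0 := fun t ht =>
      (hB₂ t (abs_le.mp ht)).trans (le_max_left _ _)
    obtain ⟨⟨M, hM⟩, heq⟩ := ih n (max B₂ 0) (le_max_right _ _)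
    refine ⟨⟨M, ?_⟩, fun ε hε => ?_⟩
    · rintro (_ | ⟨W, b, rest⟩) ⟨hW, hb, hrest⟩ z hz
      exact hM rest hrest _ fun i => hσB _ (haff hW hb z hz i)
    · obtain ⟨η₂, hη₂, h₂⟩ := heq ε hε
      have huc := (isCompact_Icc (a := -B₁) (b := B₁)).uniformContinuousOn_of_continuous
        hσ.continuousOn
      obtain ⟨η₁, hη₁, h₁⟩ := Metric.uniformContinuousOn_iff.mp huc η₂ hη₂
      refine ⟨(η₁ / 2) / (m * R + 1), by positivity, ?_⟩
      rintro (_ | ⟨W, b, rest⟩) ⟨hW, hb, hrest⟩ z z' hz hz' hzz'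
      refine h₂ rest hrest _ _ (fun i => hσB _ (haff hW hb z hz i))
        (fun i => hσB _ (haff hW hb z' hz' i)) fun i => ?_
      refine (h₁ _ (abs_le.mp (haff hW hb z hz i)) _ (abs_le.mp (haff hW hb z' hz' i)) ?_).le
      exact (hdiff hW le_rfl z z' hzz' (by positivity) i).trans_lt (by linarith)

lemma NetParams.continuous_realize {σ : ℝ → ℝ} (hσ : Continuous σ) :
    ∀ {m : ℕ} {ws : List ℕ} (θ : NetParams m ws), Continuous (θ.realize σ)
  | _, _, .output W b => by
    change Continuous fun z => (W.mulVec z + b) 0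
    fun_prop
  | _, _, .hidden W b rest => by
    change Continuous fun z => rest.realize σ fun i => σ ((W.mulVec z + b) i)
    refine (rest.continuous_realize hσ).comp (continuous_pi fun i => hσ.comp ?_)
    fun_prop

/-! ### The generalization gap -/

/-- In dimension `0` the hypothesis is empty, but the domain is a single point. -/
lemma continuousOn_of_hatVHK_lt_top {d : ℕ} {f : (Fin d → ℝ) → ℝ} (hf : hatVHK d f < ⊤) :
    ContinuousOn f (unitCube d) := by
  cases d with
  | zero => exact (continuous_of_const fun x y => by rw [Subsingleton.elim x y]).continuousOn
  | succ d =>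
    rw [hatVHK] at hf
    have h := (ENNReal.add_lt_top.mp hf).1
    rw [mixedDerivL1, iInf_lt_top] at h
    obtain ⟨g, hg⟩ := h
    obtain ⟨hfg, -⟩ := iInf_lt_top.mp hg
    exact hfg.continuousOn

theorem lemma2 (d : ℕ) (L : (Fin d → ℝ) → ℝ) (hL : hatVHK d L < ⊤)
    (σ : ℝ → ℝ) (hσ : ContDiff ℝ (d : ℕ∞) σ) (ws : List ℕ)
    (R A δ : ℝ) (hδ : 0 < δ) :
    ∃ C : ℝ, ∀ (N : ℕ), 1 ≤ N → ∀ y : Fin N → Fin d → ℝ, IsLowDiscrepancy A y →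
      ∀ θ : NetParams d ws, θ.BoundedBy R →
        generalizationError L (θ.realize σ) ≤
          trainingError L (θ.realize σ) y + C * Real.log (N : ℝ) ^ d / (N : ℝ) + 2 * δ := by
  have hLc := continuousOn_of_hatVHK_lt_top hL
  have hcube : IsCompact (unitCube d) := isCompact_Icc
  have habs : ∀ x ∈ unitCube d, ∀ i, |x i| ≤ 1 := fun x hx i =>
    abs_le.mpr ⟨by linarith [show (0 : ℝ) ≤ x i from hx.1 i], hx.2 i⟩
  by_cases hR : 0 ≤ R
  swap
  · -- A network has an output bias, so none is bounded by a negative number.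
    have hempty : ∀ {m : ℕ} {us : List ℕ} (θ : NetParams m us), ¬ θ.BoundedBy R := by
      intro m us θ
      induction θ with
      | output W b => exact fun h => hR ((abs_nonneg _).trans (h.2 0))
      | hidden W b rest ih => exact fun h => ih h.2.2
    exact ⟨0, fun N _ y _ θ hθ => absurd hθ (hempty θ)⟩
  obtain ⟨⟨M₁, hM₁⟩, hequi⟩ :=
    NetParams.exists_bound_and_equicontinuous hσ.continuous hR ws d 1 zero_le_one
  obtain ⟨M₂, hM₂⟩ := hcube.exists_bound_of_continuousOn hLc
  obtain ⟨η₁, hη₁, h₁⟩ := hequi (δ / 2) (half_pos hδ)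
  obtain ⟨η₂, hη₂, h₂⟩ := Metric.uniformContinuousOn_iff.mp
    (hcube.uniformContinuousOn_of_continuous hLc) (δ / 2) (half_pos hδ)
  obtain ⟨k, hk⟩ := exists_nat_one_div_lt (lt_min hη₁ hη₂)
  have hk' : 1 / ((k + 1 : ℕ) : ℝ) < min η₁ η₂ := by exact_mod_cast hk
  set m : ℕ := k + 1
  set M : ℝ := max (M₂ + M₁) 0
  have hM0 : 0 ≤ M := le_max_right _ _
  refine ⟨(m : ℝ) ^ d * (M * (2 ^ d * A)), fun N hN y hy θ hθ => ?_⟩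
  have hθc := θ.continuous_realize hσ.continuous
  have hbound : ∀ x ∈ unitCube d, |L x - θ.realize σ x| ≤ M := fun x hx =>
    ((abs_sub _ _).trans (add_le_add (hM₂ x hx) (hM₁ θ hθ x (habs x hx)))).trans (le_max_left _ _)
  have hosc : ∀ x ∈ unitCube d, ∀ x' ∈ unitCube d, dist x x' ≤ 1 / (m : ℝ) →
      |(|L x - θ.realize σ x|) - (|L x' - θ.realize σ x'|)| ≤ δ := by
    intro x hx x' hx' hd
    have hd' := hd.trans_lt hk'
    have hLx : |L x - L x'| < δ / 2 := h₂ x hx x' hx' (hd'.trans_le (min_le_right _ _))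
    have hθx := h₁ θ hθ x x' (habs x hx) (habs x' hx') fun i =>
      (dist_le_pi_dist x x' i).trans (hd'.le.trans (min_le_left _ _))
    refine (abs_abs_sub_abs_le _ _).trans ?_
    rw [sub_sub_sub_comm]
    refine (abs_sub _ _).trans ?_
    linarith
  have hmain := setIntegral_le_average_add (m := m) (Nat.succ_pos k) hN
    (hLc.sub hθc.continuousOn).abs (fun _ => abs_nonneg _) hδ.le hbound hosc hy.mem
  have hdisc : (m : ℝ) ^ d * (M * (2 ^ d * starDiscrepancy y)) ≤
      (m : ℝ) ^ d * (M * (2 ^ d * A)) * Real.log (N : ℝ) ^ d / (N : ℝ) := by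
    calc _ ≤ (m : ℝ) ^ d * (M * (2 ^ d * (A * Real.log (N : ℝ) ^ d / (N : ℝ)))) := by
          gcongr
          exact hy.bound
      _ = _ := by ring
  simp only [Pi.sub_apply] at hmain
  rw [generalizationError, trainingError]
  linarith
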